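/- Transitive closure logic FO(TC) extends first-order logic over graphs by the formulas $[\mathrm{TC}_{\bar x,\bar y}\,\varphi(\bar x,\bar y,\bar z)]\,\bar s,\bar t$, where $\bar x,\bar y,\bar s,\bar t$ are tuples of variables of the same length $k>0$ and the variables in $\bar x,\bar y$ are pairwise distinct; the formula says that $(\bar s,\bar t)$ belongs to the transitive closure of the relation $\{(\bar a,\bar b) : \varphi(\bar a,\bar b,\bar z)\}$ on $k$-tuples of vertices. The variables $\bar z$ are called the parameters of the TC operator. Let $\mathrm{FO(TC)}_{(1)}^2$ be the set of FO(TC)-formulas in which all TC operators have arity $k=1$ and the nesting depth of TC operators is at most $2$. Let $\mathcal G=(\omega^2,S_1,S_2)$ be the infinite grid, where $S_1=\{((m,n),(m+1,n)) : m,n\in\omega\}$ and $S_2=\{((m,n),(m,n+1)) : m,n\in\omega\}$. Then the $\mathrm{FO(TC)}_{(1)}^2$-theory of $\mathcal G$, i.e. the set of $\mathrm{FO(TC)}_{(1)}^2$-sentences true in $\mathcal G$, is undecidable. It remains undecidable if only TC operators without parameters are allowed. Moreover, $(\mathbb N,+,\cdot)$ is interpretable in $\mathcal G$ by $\mathrm{FO(TC)}_{(1)}^2$-formulas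 without parameters in the TC operators: identifying $n$ with the vertex $(n,0)$, there are such formulas that define the set $\{(n,0) : n\in\omega\}$ and the graphs of addition and multiplication on it. -/

import Mathlib

namespace FOTC

/-- Formulas of transitive closure logic FO(TC) over directed graphs whose edges are labelled by
elements of `A`.  Variables are natural numbers.  Negation, conjunction and existential
quantification are primitive; the other connectives and `∀` are the usual abbreviations.
`tc k hk x y h φ s t` is `[TC_{x̄,ȳ} φ] s̄,t̄`, where `x̄, ȳ, s̄, t̄` are tuples of variables of the
same length `k > 0` and the variables `x₁,…,x_k,y₁,…,y_k` are pairwise distinct. -/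
inductive Formula (A : Type) : Type
  | eq (x y : ℕ) : Formula A
  | edge (a : A) (x y : ℕ) : Formula A
  | neg (φ : Formula A) : Formula A
  | and (φ ψ : Formula A) : Formula A
  | ex (x : ℕ) (φ : Formula A) : Formula A
  | tc (k : ℕ) (hk : 0 < k) (x y : Fin k → ℕ) (h : Function.Injective (Sum.elim x y))
      (φ : Formula A) (s t : Fin k → ℕ) : Formula A

namespace Formula

variable {A : Type}

/-- Free variables.  In `[TC_{x̄,ȳ} φ] s̄,t̄` the variables `x̄, ȳ` are bound in `φ`, while
`s̄, t̄` occur free. -/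
def free : Formula A → Finset ℕ
  | eq x y => {x, y}
  | edge _ x y => {x, y}
  | neg φ => φ.free
  | and φ ψ => φ.free ∪ ψ.free
  | ex x φ => φ.free \ {x}
  | tc _ _ x y _ φ s t =>
      (φ.free \ (Finset.univ.image x ∪ Finset.univ.image y)) ∪
        (Finset.univ.image s ∪ Finset.univ.image t)

/-- The largest length `k` of the tuples bound by a TC operator in the formula (`0` if there is no
TC operator). -/
def arity : Formula A → ℕ
  | eq _ _ => 0
  | edge _ _ _ => 0
  | neg φ => φ.arity
  | and φ ψ => max φ.arity ψ.arity
  | ex _ φ => φ.arity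
  | tc k _ _ _ _ φ _ _ => max k φ.arity

/-- Nesting depth of TC operators. -/
def depth : Formula A → ℕ
  | eq _ _ => 0
  | edge _ _ _ => 0
  | neg φ => φ.depth
  | and φ ψ => max φ.depth ψ.depth
  | ex _ φ => φ.depth
  | tc _ _ _ _ _ φ _ _ => φ.depth + 1

/-- No TC operator in the formula has parameters: every free variable of the formula under
`TC_{x̄,ȳ}` is among `x̄, ȳ`. -/
def ParamFree : Formula A → Prop
  | eq _ _ => True
  | edge _ _ _ => True
  | neg φ => φ.ParamFree
  | and φ ψ => φ.ParamFree ∧ ψ.ParamFree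
  | ex _ φ => φ.ParamFree
  | tc _ _ x y _ φ _ _ =>
      φ.free ⊆ Finset.univ.image x ∪ Finset.univ.image y ∧ φ.ParamFree

/-- `φ.Sat E v`: the formula `φ` holds under the assignment `v` in the graph with vertex set `V`
and edge relations `E a`, `a : A`.  For a TC formula, `Relation.TransGen` is the transitive closure
of the relation on `k`-tuples that `φ` defines when `x̄, ȳ` are assigned the two tuples and all
other variables keep their values. -/
def Sat {V : Type} (E : A → V → V → Prop) : (ℕ → V) → Formula A → Prop
  | v, eq x y => v x = v y
  | v, edge a x y => E a (v x) (v y)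
  | v, neg φ => ¬ Sat E v φ
  | v, and φ ψ => Sat E v φ ∧ Sat E v ψ
  | v, ex x φ => ∃ d : V, Sat E (Function.update v x d) φ
  | v, tc k _ x y _ φ s t =>
      Relation.TransGen
        (fun a b : Fin k → V => Sat E (Function.extend (Sum.elim x y) (Sum.elim a b) v) φ)
        (fun i => v (s i)) (fun i => v (t i))

/-- Gödel numbering of formulas over the finite label set `Fin n`. -/
def code {n : ℕ} : Formula (Fin n) → ℕ
  | eq x y => Nat.pair 0 (Nat.pair x y)
  | edge a x y => Nat.pair 1 (Nat.pair a.val (Nat.pair x y))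
  | neg φ => Nat.pair 2 φ.code
  | and φ ψ => Nat.pair 3 (Nat.pair φ.code ψ.code)
  | ex x φ => Nat.pair 4 (Nat.pair x φ.code)
  | tc _ _ x y _ φ s t =>
      Nat.pair 5 (Nat.pair (Encodable.encode (List.ofFn x)) (Nat.pair (Encodable.encode (List.ofFn y))
        (Nat.pair φ.code
          (Nat.pair (Encodable.encode (List.ofFn s)) (Encodable.encode (List.ofFn t))))))

/-- Distinct formulas have distinct Gödel numbers. -/
theorem code_injective {n : ℕ} : Function.Injective (code (n := n)) := by
  intro φ
  induction φ with
  | eq x y => intro ψ h; cases ψ <;> simp_all [code, Nat.pair_eq_pair]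
  | edge a x y => intro ψ h; cases ψ <;> simp_all [code, Nat.pair_eq_pair, Fin.ext_iff]
  | neg φ ih =>
    intro ψ h
    cases ψ <;> simp [code, Nat.pair_eq_pair] at h
    rw [ih h]
  | and φ₁ φ₂ ih₁ ih₂ =>
    intro ψ h
    cases ψ <;> simp [code, Nat.pair_eq_pair] at h
    rw [ih₁ h.1, ih₂ h.2]
  | ex x φ ih =>
    intro ψ h
    cases ψ <;> simp [code, Nat.pair_eq_pair] at h
    rw [h.1, ih h.2]
  | tc k hk x y hxy φ s t ih =>
    intro ψ h
    cases ψ with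
    | tc k' hk' x' y' hxy' φ' s' t' =>
      simp only [code, Nat.pair_eq_pair, true_and, Encodable.encode_inj] at h
      obtain ⟨hx, hy, hφ, hs, ht⟩ := h
      have hkk : k = k' := by simpa using congrArg List.length hx
      subst hkk
      obtain rfl := List.ofFn_injective hx
      obtain rfl := List.ofFn_injective hy
      obtain rfl := List.ofFn_injective hs
      obtain rfl := List.ofFn_injective ht
      rw [ih hφ]
    | _ => simp [code, Nat.pair_eq_pair] at h

end Formula

/-- The fragment FO(TC)_(k)^l: TC operators bind tuples of length at most `k`, and their nesting
depth is at most `l`. -/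
def Fragment (A : Type) (k l : ℕ) : Set (Formula A) :=
  {φ | φ.arity ≤ k ∧ φ.depth ≤ l}

/-- The fragment of FO(TC)_(k)^l without parameters in the TC operators. -/
def ParamFreeFragment (A : Type) (k l : ℕ) : Set (Formula A) :=
  {φ | φ ∈ Fragment A k l ∧ φ.ParamFree}

/-- The theory, in the logic with set of formulas `L`, of the graph with edge relations `E`: the
sentences of `L` that hold in the graph. -/
def theoryIn {A V : Type} (L : Set (Formula A)) (E : A → V → V → Prop) : Set (Formula A) :=
  {φ | φ ∈ L ∧ φ.free = ∅ ∧ ∀ v : ℕ → V, φ.Sat E v}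

/-- A set of formulas is decidable if the set of the Gödel numbers of its members is computable. -/
def IsDecidable {n : ℕ} (T : Set (Formula (Fin n))) : Prop :=
  ComputablePred fun m : ℕ => ∃ φ ∈ T, φ.code = m

/-- The infinite grid `(ω², S₁, S₂)`: label `0` is the successor relation `S₁` in the first
coordinate, label `1` is the successor relation `S₂` in the second coordinate. -/
def grid (a : Fin 2) (u v : ℕ × ℕ) : Prop :=
  if a = 0 then v = (u.1 + 1, u.2) else v = (u.1, u.2 + 1)

/-- The formula `φ`, with free variables among `0, 1, 2`, defines in the grid the graph of
`f : ℕ → ℕ → ℕ`, where `n : ℕ` is identified with the vertex `(n, 0)`. -/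
def DefinesOp (φ : Formula (Fin 2)) (f : ℕ → ℕ → ℕ) : Prop :=
  φ.free ⊆ {0, 1, 2} ∧ ∀ v : ℕ → ℕ × ℕ,
    φ.Sat grid v ↔ ∃ a b : ℕ, v 0 = (a, 0) ∧ v 1 = (b, 0) ∧ v 2 = (f a b, 0)

/-- `(ℕ, +, ·)` is interpretable in the grid by formulas of `L`, with `n ↦ (n, 0)`: its domain,
addition and multiplication are defined by formulas of `L`. -/
def InterpretsArithmetic (L : Set (Formula (Fin 2))) : Prop :=
  (∃ δ ∈ L, δ.free ⊆ {0} ∧ ∀ v : ℕ → ℕ × ℕ, δ.Sat grid v ↔ ∃ a : ℕ, v 0 = (a, 0)) ∧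
  (∃ φ ∈ L, DefinesOp φ (fun a b => a + b)) ∧
  (∃ φ ∈ L, DefinesOp φ (fun a b => a * b))

end FOTC

namespace FOTC

open Relation

/-! ### The unary TC operator and its semantics -/

namespace Formula

variable {A V : Type}

/-! Antidiagonals give addition: $(b,0)$ shares its antidiagonal with $(0,b)$, the row of $(0,b)$
meets the column of $(a,0)$ in $(a,b)$, and the antidiagonal of $(a,b)$ ends in $(a+b,0)$. Rows,
columns and antidiagonals are closures of first-order steps, so this costs TC depth 1.

Multiplication needs one more level. The step $(m,n)\mapsto(m+1,m+n+1)$ is definable by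
antidiagonals and mentions only its two endpoints, so its closure has no parameters; starting at the
origin it visits exactly the points $(k,T_k)$ with $T_k$ triangular (`sat_trianglePath`). Since
$T_{a+b}=T_a+T_b+ab$ (`triangle_add`), the product is definable from $T$ and addition
(`sat_mulFormula`).

For undecidability, Gödel's β-function shows that graphs of partial recursive functions are
definable from $+$ and $\cdot$ (`arithDef_of_partrec`), hence so is the halting set.
`ArithDef.exists_formula` turns such definitions into formulas over the grid, and inserting the
numeral $k$ into the formula for halting is a computable map on Gödel numbers. This many-one reduces
the halting problem to the theory (`not_isDecidable_theoryIn`). -/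

/-- Disjunction. -/
def or (φ ψ : Formula A) : Formula A := neg (and (neg φ) (neg ψ))

/-- The TC operator of arity `1`. -/
def tc₁ (x y : ℕ) (h : x ≠ y) (φ : Formula A) (s t : ℕ) : Formula A :=
  tc 1 one_pos (fun _ => x) (fun _ => y)
    (by
      rintro (i | i) (j | j) hij
      · exact congrArg Sum.inl (Subsingleton.elim i j)
      · exact absurd hij h
      · exact absurd hij.symm h
      · exact congrArg Sum.inr (Subsingleton.elim i j))
    φ (fun _ => s) (fun _ => t)

/-- The reflexive transitive closure operator of arity `1`. -/
def rtc₁ (x y : ℕ) (h : x ≠ y) (φ : Formula A) (s t : ℕ) : Formula A :=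
  or (eq t s) (tc₁ x y h φ s t)

theorem sat_or {E : A → V → V → Prop} {v : ℕ → V} {φ ψ : Formula A} :
    (or φ ψ).Sat E v ↔ φ.Sat E v ∨ ψ.Sat E v := by
  simp only [or, Sat]; tauto

/-- Distinctness of the two bound variables makes the indexing map injective, so `Function.extend`
takes the prescribed values there. -/
theorem extend_sum_elim_const {x y : ℕ} (h : x ≠ y) (v : ℕ → V) (a b : Fin 1 → V) :
    Function.extend (Sum.elim (fun _ : Fin 1 => x) (fun _ : Fin 1 => y)) (Sum.elim a b) v =
      Function.update (Function.update v x (a 0)) y (b 0) := by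
  have hinj : Function.Injective (Sum.elim (fun _ : Fin 1 => x) (fun _ : Fin 1 => y)) := by
    rintro (i | i) (j | j) hij
    · exact congrArg Sum.inl (Subsingleton.elim i j)
    · exact absurd hij h
    · exact absurd hij.symm h
    · exact congrArg Sum.inr (Subsingleton.elim i j)
  funext z
  by_cases hy : z = y
  · subst hy
    simpa using hinj.extend_apply (Sum.elim a b) v (Sum.inr 0)
  by_cases hx : z = x
  · subst hx
    simpa [hy] using hinj.extend_apply (Sum.elim a b) v (Sum.inl 0)
  · rw [Function.extend_apply' _ _ _ (by rintro ⟨i | i, hi⟩ <;> simp at hi <;> omega)]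
    simp [hx, hy]

theorem sat_tc₁ {E : A → V → V → Prop} {v : ℕ → V} {x y : ℕ} {h : x ≠ y} {φ : Formula A}
    {s t : ℕ} :
    (tc₁ x y h φ s t).Sat E v ↔
      TransGen (fun a b => φ.Sat E (Function.update (Function.update v x a) y b)) (v s) (v t) := by
  simp only [tc₁, Sat, extend_sum_elim_const h]
  constructor
  · intro H
    -- The relation depends on a 1-tuple only through its entry, so chains transfer along `a ↦ a 0`,
    -- and back along constant tuples.
    exact TransGen.lift
      (p := fun a b => φ.Sat E (Function.update (Function.update v x a) y b))
      (fun a : Fin 1 → V => a 0) (fun _ _ h => h) _ _ H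
  · exact fun H => H.lift (fun a _ => a) fun _ _ h => h

theorem sat_rtc₁ {E : A → V → V → Prop} {v : ℕ → V} {x y : ℕ} {h : x ≠ y} {φ : Formula A}
    {s t : ℕ} :
    (rtc₁ x y h φ s t).Sat E v ↔
      ReflTransGen (fun a b => φ.Sat E (Function.update (Function.update v x a) y b))
        (v s) (v t) := by
  rw [rtc₁, sat_or, sat_tc₁, reflTransGen_iff_eq_or_transGen, Sat]

theorem free_or (φ ψ : Formula A) : (or φ ψ).free = φ.free ∪ ψ.free := rfl

theorem free_rtc₁_subset {x y : ℕ} {h : x ≠ y} {φ : Formula A} (hφ : φ.free ⊆ {x, y}) (s t : ℕ) :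
    (rtc₁ x y h φ s t).free ⊆ {s, t} := by
  intro z hz
  have := @hφ z
  simp [rtc₁, free_or, tc₁, free] at hz this ⊢
  tauto

theorem free_ex_subset {x : ℕ} {φ : Formula A} {s : Finset ℕ} (h : φ.free ⊆ insert x s) :
    (ex x φ).free ⊆ s := by
  intro z hz
  have := @h z
  simp [free] at hz this ⊢
  tauto

end Formula

open Formula

/-! ### Closure properties of the parameter-free fragment -/

section Fragment

variable {A : Type} {k l : ℕ} {φ ψ : Formula A}

theorem eq_mem_fragment (x y : ℕ) : eq x y ∈ ParamFreeFragment A k l := by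
  simp [ParamFreeFragment, Fragment, arity, depth, ParamFree]

theorem edge_mem_fragment (a : A) (x y : ℕ) : edge a x y ∈ ParamFreeFragment A k l := by
  simp [ParamFreeFragment, Fragment, arity, depth, ParamFree]

theorem neg_mem_fragment (h : φ ∈ ParamFreeFragment A k l) : neg φ ∈ ParamFreeFragment A k l := h

theorem and_mem_fragment (h : φ ∈ ParamFreeFragment A k l) (h' : ψ ∈ ParamFreeFragment A k l) :
    and φ ψ ∈ ParamFreeFragment A k l :=
  ⟨⟨max_le h.1.1 h'.1.1, max_le h.1.2 h'.1.2⟩, h.2, h'.2⟩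

theorem or_mem_fragment (h : φ ∈ ParamFreeFragment A k l) (h' : ψ ∈ ParamFreeFragment A k l) :
    or φ ψ ∈ ParamFreeFragment A k l :=
  neg_mem_fragment (and_mem_fragment (neg_mem_fragment h) (neg_mem_fragment h'))

theorem ex_mem_fragment (x : ℕ) (h : φ ∈ ParamFreeFragment A k l) :
    ex x φ ∈ ParamFreeFragment A k l := h

theorem rtc₁_mem_fragment {x y : ℕ} (hxy : x ≠ y) (hfree : φ.free ⊆ {x, y})
    (h : φ ∈ ParamFreeFragment A 1 l) (s t : ℕ) :
    rtc₁ x y hxy φ s t ∈ ParamFreeFragment A 1 (l + 1) := by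
  refine or_mem_fragment (eq_mem_fragment _ _)
    ⟨⟨max_le le_rfl h.1.1, Nat.succ_le_succ h.1.2⟩, ?_, h.2⟩
  intro z hz
  simpa using hfree hz

end Fragment

/-! ### Rows, columns, antidiagonals and the triangular path -/

section Grid

/-- `x` lies on the horizontal axis. -/
def onAxis (x : ℕ) : Formula (Fin 2) := neg (ex (x + 1) (edge 1 (x + 1) x))

/-- `x` lies on the vertical axis. -/
def onLeft (x : ℕ) : Formula (Fin 2) := neg (ex (x + 1) (edge 0 (x + 1) x))

/-- `t` is in the row of `s`, weakly to the right of `s`. -/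
def rightOf (s t : ℕ) : Formula (Fin 2) := rtc₁ 0 1 zero_ne_one (edge 0 0 1) s t

/-- `t` is in the column of `s`, weakly above `s`. -/
def above (s t : ℕ) : Formula (Fin 2) := rtc₁ 0 1 zero_ne_one (edge 1 0 1) s t

/-- `t` is on the antidiagonal of `s`, weakly above `s`. -/
def antidiag (s t : ℕ) : Formula (Fin 2) :=
  rtc₁ 0 1 zero_ne_one (ex 2 (and (edge 0 2 0) (edge 1 2 1))) s t

/-- The vertex `1` is `(m + 1, m + n + 1)`, where the vertex `0` is `(m, n)`. -/
def triangleStep : Formula (Fin 2) :=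
  ex 2 (and (edge 0 0 2) (ex 3 (and (and (antidiag 2 3) (onLeft 3))
    (and (rightOf 3 1) (above 2 1)))))

/-- `t` is obtained from `s` by steps `(m, n) ↦ (m + 1, m + n + 1)`. -/
def trianglePath (s t : ℕ) : Formula (Fin 2) := rtc₁ 0 1 zero_ne_one triangleStep s t

variable {v : ℕ → ℕ × ℕ}

theorem sat_onAxis {x : ℕ} : (onAxis x).Sat grid v ↔ (v x).2 = 0 := by
  rcases h : v x with ⟨a, _ | b⟩ <;> simp [onAxis, Sat, grid, h]

theorem sat_onLeft {x : ℕ} : (onLeft x).Sat grid v ↔ (v x).1 = 0 := by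
  rcases h : v x with ⟨_ | a, b⟩ <;> simp [onLeft, Sat, grid, h]

/-- Rows, columns and the triangular path are closures of graphs of total functions, so reachability
reduces to computing iterates. The antidiagonal step is undefined on the vertical axis and is
treated directly. -/
theorem reflTransGen_iterate_iff {α : Type*} (g : α → α) (u w : α) :
    ReflTransGen (fun a b => b = g a) u w ↔ ∃ k, w = g^[k] u := by
  constructor
  · intro h
    induction h with
    | refl => exact ⟨0, rfl⟩
    | tail _ hbc ih =>
      obtain ⟨k, rfl⟩ := ih
      exact ⟨k + 1, by rw [hbc, Function.iterate_succ_apply']⟩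
  · rintro ⟨k, rfl⟩
    induction k with
    | zero => exact .refl
    | succ k ih => exact ih.tail (Function.iterate_succ_apply' g k u)

theorem sat_rightOf {s t : ℕ} :
    (rightOf s t).Sat grid v ↔ (v t).2 = (v s).2 ∧ (v s).1 ≤ (v t).1 := by
  have key (k : ℕ) (u : ℕ × ℕ) : (fun a : ℕ × ℕ => (a.1 + 1, a.2))^[k] u = (u.1 + k, u.2) := by
    induction k with
    | zero => rfl
    | succ k ih => rw [Function.iterate_succ_apply', ih]; rfl
  rw [rightOf, sat_rtc₁]
  simp only [Sat, grid, Function.update_self, Function.update_of_ne zero_ne_one, if_true]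
  rw [reflTransGen_iterate_iff (fun a : ℕ × ℕ => (a.1 + 1, a.2))]
  simp [key, Prod.ext_iff, le_iff_exists_add, and_comm]

theorem sat_above {s t : ℕ} :
    (above s t).Sat grid v ↔ (v t).1 = (v s).1 ∧ (v s).2 ≤ (v t).2 := by
  have key (k : ℕ) (u : ℕ × ℕ) : (fun a : ℕ × ℕ => (a.1, a.2 + 1))^[k] u = (u.1, u.2 + k) := by
    induction k with
    | zero => rfl
    | succ k ih => rw [Function.iterate_succ_apply', ih]; rfl
  rw [above, sat_rtc₁]
  simp only [Sat, grid, Function.update_self, Function.update_of_ne zero_ne_one, one_ne_zero,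
    if_false]
  rw [reflTransGen_iterate_iff (fun a : ℕ × ℕ => (a.1, a.2 + 1))]
  simp [key, Prod.ext_iff, le_iff_exists_add]

theorem sat_antidiag {s t : ℕ} :
    (antidiag s t).Sat grid v ↔
      (v t).1 + (v t).2 = (v s).1 + (v s).2 ∧ (v s).2 ≤ (v t).2 := by
  rw [antidiag, sat_rtc₁]
  simp only [Sat, grid]
  generalize v s = a
  generalize v t = b
  constructor
  · intro h
    induction h with
    | refl => simp
    | tail _ hbc ih =>
      simp [Prod.ext_iff] at hbc
      omega
  · obtain ⟨a₁, a₂⟩ := a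
    obtain ⟨b₁, b₂⟩ := b
    rintro ⟨h, h'⟩
    obtain ⟨k, rfl⟩ := le_iff_exists_add.1 h'
    obtain rfl : a₁ = b₁ + k := by simp at h; omega
    clear h h'
    -- With the start held fixed, the path of length $k$ ends at $(b_1+1,a_2+k)$; one more step
    -- reaches $(b_1,a_2+k+1)$.
    induction k generalizing b₁ with
    | zero => exact .refl
    | succ k ih =>
      have := ih (b₁ + 1)
      rw [add_assoc, add_comm 1 k] at this
      exact this.tail (by simp [Prod.ext_iff]; omega)

/-- The triangular numbers. -/
def triangle : ℕ → ℕ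
  | 0 => 0
  | n + 1 => triangle n + n + 1

theorem triangle_add (a b : ℕ) : triangle (a + b) = triangle a + triangle b + a * b := by
  induction b with
  | zero => simp [triangle]
  | succ b ih => rw [← add_assoc, triangle, ih, triangle]; ring

/-- From $(m,n)$ move right to $(m+1,n)$ and follow its antidiagonal to $(0,m+n+1)$; the row of that
point meets the column of $(m+1,n)$ in the target. -/
theorem sat_triangleStep :
    triangleStep.Sat grid v ↔ v 1 = ((v 0).1 + 1, (v 0).1 + (v 0).2 + 1) := by
  simp only [triangleStep, Sat, sat_antidiag, sat_onLeft, sat_rightOf, sat_above, grid,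
    Function.update_self, Prod.exists, Prod.ext_iff]
  simp
  omega

theorem sat_trianglePath {s t : ℕ} (hs : v s = (0, 0)) :
    (trianglePath s t).Sat grid v ↔ (v t).2 = triangle (v t).1 := by
  have key (k : ℕ) :
      (fun a : ℕ × ℕ => (a.1 + 1, a.1 + a.2 + 1))^[k] (0, 0) = (k, triangle k) := by
    induction k with
    | zero => rfl
    | succ k ih => rw [Function.iterate_succ_apply', ih]; simp [triangle]; ring
  rw [trianglePath, sat_rtc₁, hs]
  simp only [sat_triangleStep, Function.update_self, Function.update_of_ne zero_ne_one]
  rw [reflTransGen_iterate_iff (fun a : ℕ × ℕ => (a.1 + 1, a.1 + a.2 + 1))]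
  simp [key, Prod.ext_iff]

theorem onAxis_mem (x l : ℕ) : onAxis x ∈ ParamFreeFragment (Fin 2) 1 l :=
  neg_mem_fragment (ex_mem_fragment _ (edge_mem_fragment _ _ _))

theorem onLeft_mem (x l : ℕ) : onLeft x ∈ ParamFreeFragment (Fin 2) 1 l :=
  neg_mem_fragment (ex_mem_fragment _ (edge_mem_fragment _ _ _))

theorem rightOf_mem (s t l : ℕ) : rightOf s t ∈ ParamFreeFragment (Fin 2) 1 (l + 1) :=
  rtc₁_mem_fragment _ subset_rfl (edge_mem_fragment _ _ _) _ _

theorem above_mem (s t l : ℕ) : above s t ∈ ParamFreeFragment (Fin 2) 1 (l + 1) :=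
  rtc₁_mem_fragment _ subset_rfl (edge_mem_fragment _ _ _) _ _

theorem antidiag_mem (s t l : ℕ) : antidiag s t ∈ ParamFreeFragment (Fin 2) 1 (l + 1) :=
  rtc₁_mem_fragment _ (by decide)
    (ex_mem_fragment _ (and_mem_fragment (edge_mem_fragment _ _ _) (edge_mem_fragment _ _ _))) _ _

theorem trianglePath_mem (s t : ℕ) : trianglePath s t ∈ ParamFreeFragment (Fin 2) 1 2 :=
  rtc₁_mem_fragment _ (by decide)
    (ex_mem_fragment _ (and_mem_fragment (edge_mem_fragment _ _ _)
      (ex_mem_fragment _ (and_mem_fragment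
        (and_mem_fragment (antidiag_mem _ _ _) (onLeft_mem _ _))
        (and_mem_fragment (rightOf_mem _ _ _) (above_mem _ _ _)))))) _ _

theorem free_onAxis (x : ℕ) : (onAxis x).free = {x} := by
  ext z; simp [onAxis, free]; omega

theorem free_onLeft (x : ℕ) : (onLeft x).free = {x} := by
  ext z; simp [onLeft, free]; omega

theorem free_rightOf (s t : ℕ) : (rightOf s t).free ⊆ {s, t} :=
  free_rtc₁_subset subset_rfl _ _

theorem free_above (s t : ℕ) : (above s t).free ⊆ {s, t} :=
  free_rtc₁_subset subset_rfl _ _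

theorem free_antidiag (s t : ℕ) : (antidiag s t).free ⊆ {s, t} :=
  free_rtc₁_subset (by decide) _ _

theorem free_trianglePath (s t : ℕ) : (trianglePath s t).free ⊆ {s, t} :=
  free_rtc₁_subset (by decide) _ _

end Grid

/-! ### Addition and multiplication on the horizontal axis -/

section Arithmetic

/-- `z = x + y` on the horizontal axis. -/
def addFormula (x y z : ℕ) : Formula (Fin 2) :=
  and (and (onAxis x) (and (onAxis y) (onAxis z)))
    (ex (x + y + z + 1) (ex (x + y + z + 2)
      (and (and (onLeft (x + y + z + 1)) (antidiag y (x + y + z + 1)))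
        (and (rightOf (x + y + z + 1) (x + y + z + 2))
          (and (above x (x + y + z + 2)) (antidiag z (x + y + z + 2)))))))

/-- `y` is the triangular number with index `x`, on the horizontal axis. -/
def triangleFormula (x y : ℕ) : Formula (Fin 2) :=
  and (and (onAxis x) (onAxis y))
    (ex (x + y + 1) (ex (x + y + 2) (ex (x + y + 3)
      (and (and (and (onAxis (x + y + 1)) (onLeft (x + y + 1)))
          (trianglePath (x + y + 1) (x + y + 2)))
        (and (above x (x + y + 2)) (and (rightOf (x + y + 3) (x + y + 2))
          (and (onLeft (x + y + 3)) (antidiag y (x + y + 3)))))))))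

/-- `z = x * y` on the horizontal axis. -/
def mulFormula (x y z : ℕ) : Formula (Fin 2) :=
  ex (x + y + z + 1) (ex (x + y + z + 2) (ex (x + y + z + 3) (ex (x + y + z + 4)
    (ex (x + y + z + 5)
      (and (and (addFormula x y (x + y + z + 1))
          (and (triangleFormula x (x + y + z + 2)) (triangleFormula y (x + y + z + 3))))
        (and (triangleFormula (x + y + z + 1) (x + y + z + 4))
          (and (addFormula (x + y + z + 2) (x + y + z + 3) (x + y + z + 5))
            (addFormula (x + y + z + 5) z (x + y + z + 4)))))))))

variable {v : ℕ → ℕ × ℕ}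

theorem sat_addFormula {x y z : ℕ} :
    (addFormula x y z).Sat grid v ↔
      ((v x).2 = 0 ∧ (v y).2 = 0 ∧ (v z).2 = 0) ∧ (v x).1 + (v y).1 = (v z).1 := by
  simp only [addFormula]
  -- Bound variables are indexed above the sum of the free ones, so they are fresh for any choice of
  -- names, even with repetitions.
  generalize hn : x + y + z = n
  have hx₁ : x ≠ n + 1 := by omega
  have hx₂ : x ≠ n + 2 := by omega
  have hy₁ : y ≠ n + 1 := by omega
  have hy₂ : y ≠ n + 2 := by omega
  have hz₁ : z ≠ n + 1 := by omega
  have hz₂ : z ≠ n + 2 := by omega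
  simp only [Sat, sat_onAxis, sat_onLeft, sat_antidiag, sat_rightOf, sat_above, Prod.exists]
  refine and_congr_right fun h => ?_
  simp [*]

theorem sat_triangleFormula {x y : ℕ} :
    (triangleFormula x y).Sat grid v ↔
      ((v x).2 = 0 ∧ (v y).2 = 0) ∧ triangle (v x).1 = (v y).1 := by
  simp only [triangleFormula]
  generalize hn : x + y = n
  have hx₁ : x ≠ n + 1 := by omega
  have hx₂ : x ≠ n + 2 := by omega
  have hx₃ : x ≠ n + 3 := by omega
  have hy₁ : y ≠ n + 1 := by omega
  have hy₂ : y ≠ n + 2 := by omega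
  have hy₃ : y ≠ n + 3 := by omega
  simp only [Sat, sat_onAxis, sat_onLeft, sat_antidiag, sat_rightOf, sat_above]
  refine and_congr_right fun h => ?_
  constructor
  · rintro ⟨o, p, q, ⟨⟨h₁, h₂⟩, h₃⟩, h₄⟩
    rw [sat_trianglePath (by simpa [Prod.ext_iff] using And.intro h₂ h₁)] at h₃
    simp [*] at h₃ h₄
    rw [h₄.1] at h₃
    omega
  · intro h'
    -- The origin, the point of the triangular path above `x`, and the left end of its row, whose
    -- antidiagonal leads down to `y`.
    refine ⟨(0, 0), ((v x).1, (v y).1), (0, (v y).1), ⟨by simp, ?_⟩, ?_⟩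
    · rw [sat_trianglePath (by simp)]
      simp [h']
    · simp [*]

/-- The auxiliary variables hold, in order, $a+b$, $T_a$, $T_b$, $T_{a+b}$ and $T_a+T_b$; the last
conjunct says $T_a+T_b+z=T_{a+b}$, which by `triangle_add` forces $z=ab$. -/
theorem sat_mulFormula {x y z : ℕ} :
    (mulFormula x y z).Sat grid v ↔
      ((v x).2 = 0 ∧ (v y).2 = 0 ∧ (v z).2 = 0) ∧ (v x).1 * (v y).1 = (v z).1 := by
  simp only [mulFormula]
  generalize hn : x + y + z = n
  have hx (k : ℕ) (hk : 0 < k) : x ≠ n + k := by omega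
  have hy (k : ℕ) (hk : 0 < k) : y ≠ n + k := by omega
  have hz (k : ℕ) (hk : 0 < k) : z ≠ n + k := by omega
  simp only [Sat, sat_addFormula, sat_triangleFormula, Prod.exists]
  simp [hx, hy, hz]
  have := triangle_add (v x).1 (v y).1
  omega

theorem addFormula_mem (x y z l : ℕ) : addFormula x y z ∈ ParamFreeFragment (Fin 2) 1 (l + 1) :=
  and_mem_fragment
    (and_mem_fragment (onAxis_mem _ _) (and_mem_fragment (onAxis_mem _ _) (onAxis_mem _ _)))
    (ex_mem_fragment _ (ex_mem_fragment _
      (and_mem_fragment (and_mem_fragment (onLeft_mem _ _) (antidiag_mem _ _ _))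
        (and_mem_fragment (rightOf_mem _ _ _)
          (and_mem_fragment (above_mem _ _ _) (antidiag_mem _ _ _))))))

theorem triangleFormula_mem (x y : ℕ) : triangleFormula x y ∈ ParamFreeFragment (Fin 2) 1 2 :=
  and_mem_fragment (and_mem_fragment (onAxis_mem _ _) (onAxis_mem _ _))
    (ex_mem_fragment _ (ex_mem_fragment _ (ex_mem_fragment _
      (and_mem_fragment (and_mem_fragment (and_mem_fragment (onAxis_mem _ _) (onLeft_mem _ _))
          (trianglePath_mem _ _))
        (and_mem_fragment (above_mem _ _ _) (and_mem_fragment (rightOf_mem _ _ _)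
          (and_mem_fragment (onLeft_mem _ _) (antidiag_mem _ _ _))))))))

theorem mulFormula_mem (x y z : ℕ) : mulFormula x y z ∈ ParamFreeFragment (Fin 2) 1 2 :=
  ex_mem_fragment _ (ex_mem_fragment _ (ex_mem_fragment _ (ex_mem_fragment _ (ex_mem_fragment _
    (and_mem_fragment (and_mem_fragment (addFormula_mem _ _ _ _)
        (and_mem_fragment (triangleFormula_mem _ _) (triangleFormula_mem _ _)))
      (and_mem_fragment (triangleFormula_mem _ _)
        (and_mem_fragment (addFormula_mem _ _ _ _) (addFormula_mem _ _ _ _))))))))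

theorem free_addFormula (x y z : ℕ) : (addFormula x y z).free ⊆ {x, y, z} := by
  intro w hw
  have h₁ := @free_antidiag y (x + y + z + 1) w
  have h₂ := @free_rightOf (x + y + z + 1) (x + y + z + 2) w
  have h₃ := @free_above x (x + y + z + 2) w
  have h₄ := @free_antidiag z (x + y + z + 2) w
  simp [addFormula, free, free_onAxis, free_onLeft] at hw h₁ h₂ h₃ h₄ ⊢
  grind

theorem free_triangleFormula (x y : ℕ) : (triangleFormula x y).free ⊆ {x, y} := by
  intro w hw
  have h₁ := @free_trianglePath (x + y + 1) (x + y + 2) w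
  have h₂ := @free_above x (x + y + 2) w
  have h₃ := @free_rightOf (x + y + 3) (x + y + 2) w
  have h₄ := @free_antidiag y (x + y + 3) w
  simp [triangleFormula, free, free_onAxis, free_onLeft] at hw h₁ h₂ h₃ h₄ ⊢
  grind

theorem free_mulFormula (x y z : ℕ) : (mulFormula x y z).free ⊆ {x, y, z} := by
  intro w hw
  have h₁ := @free_addFormula x y (x + y + z + 1) w
  have h₂ := @free_triangleFormula x (x + y + z + 2) w
  have h₃ := @free_triangleFormula y (x + y + z + 3) w
  have h₄ := @free_triangleFormula (x + y + z + 1) (x + y + z + 4) w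
  have h₅ := @free_addFormula (x + y + z + 2) (x + y + z + 3) (x + y + z + 5) w
  have h₆ := @free_addFormula (x + y + z + 5) z (x + y + z + 4) w
  simp [mulFormula, free] at hw h₁ h₂ h₃ h₄ h₅ h₆ ⊢
  grind

theorem interpretsArithmetic_paramFreeFragment :
    InterpretsArithmetic (ParamFreeFragment (Fin 2) 1 2) := by
  refine ⟨⟨onAxis 0, onAxis_mem _ _, (free_onAxis 0).subset, fun v => ?_⟩,
    ⟨addFormula 0 1 2, addFormula_mem _ _ _ _, free_addFormula _ _ _, fun v => ?_⟩,
    ⟨mulFormula 0 1 2, mulFormula_mem _ _ _, free_mulFormula _ _ _, fun v => ?_⟩⟩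
  · simp [sat_onAxis, Prod.ext_iff]
  · simp [sat_addFormula, Prod.ext_iff]; grind
  · simp [sat_mulFormula, Prod.ext_iff]; grind

end Arithmetic

end FOTC

/-! ### Arithmetically definable relations and functions -/

namespace FOTC

/-- Relations between natural numbers that are first-order definable from addition and
multiplication. -/
inductive ArithDef : {n : ℕ} → ((Fin n → ℕ) → Prop) → Prop
  | add {n : ℕ} (i j k : Fin n) : ArithDef fun v => v i + v j = v k
  | mul {n : ℕ} (i j k : Fin n) : ArithDef fun v => v i * v j = v k
  | neg {n : ℕ} {R : (Fin n → ℕ) → Prop} : ArithDef R → ArithDef fun v => ¬ R v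
  | and {n : ℕ} {R S : (Fin n → ℕ) → Prop} :
      ArithDef R → ArithDef S → ArithDef fun v => R v ∧ S v
  | ex {n : ℕ} {R : (Fin (n + 1) → ℕ) → Prop} :
      ArithDef R → ArithDef fun v => ∃ d, R (Fin.cons d v)

/-- Functions on natural numbers that are first-order definable from addition and
multiplication. -/
def ArithFun {n : ℕ} (f : (Fin n → ℕ) → ℕ) : Prop :=
  ArithDef fun v : Fin (n + 1) → ℕ => f (Fin.tail v) = v 0

namespace ArithDef

variable {n m : ℕ}

theorem of_iff {R S : (Fin n → ℕ) → Prop} (hR : ArithDef R) (h : ∀ v, S v ↔ R v) : ArithDef S :=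
  (funext fun v => propext (h v) : S = R) ▸ hR

/-- Here `σ` may identify variables or leave some unused, so this covers substitution of variables,
weakening and permutation at once. -/
theorem rename {R : (Fin n → ℕ) → Prop} (hR : ArithDef R) (σ : Fin n → Fin m) :
    ArithDef fun v => R fun i => v (σ i) := by
  induction hR generalizing m with
  | add i j k => exact add _ _ _
  | mul i j k => exact mul _ _ _
  | neg _ ih => exact (ih σ).neg
  | and _ _ ih₁ ih₂ => exact (ih₁ σ).and (ih₂ σ)
  | ex _ ih =>
    refine (ih (Fin.cons 0 fun i => (σ i).succ)).ex.of_iff fun v => exists_congr fun d => ?_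
    refine iff_of_eq (congrArg _ (funext fun i => ?_))
    cases i using Fin.cases <;> simp

theorem exists' {R : (Fin n → ℕ) → ℕ → Prop}
    (h : ArithDef fun v : Fin (n + 1) → ℕ => R (Fin.tail v) (v 0)) :
    ArithDef fun v => ∃ d, R v d :=
  h.ex.of_iff fun v => by simp

theorem or {R S : (Fin n → ℕ) → Prop} (hR : ArithDef R) (hS : ArithDef S) :
    ArithDef fun v => R v ∨ S v :=
  (hR.neg.and hS.neg).neg.of_iff fun v => by tauto

theorem imp {R S : (Fin n → ℕ) → Prop} (hR : ArithDef R) (hS : ArithDef S) :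
    ArithDef fun v => R v → S v :=
  (hR.and hS.neg).neg.of_iff fun v => by tauto

theorem forall' {R : (Fin n → ℕ) → ℕ → Prop}
    (h : ArithDef fun v : Fin (n + 1) → ℕ => R (Fin.tail v) (v 0)) :
    ArithDef fun v => ∀ d, R v d :=
  (exists' (R := fun v d => ¬ R v d) h.neg).neg.of_iff fun v => by simp

theorem eq_var (i j : Fin n) : ArithDef fun v => v i = v j := by
  -- Equality is not primitive: $d+d=d$ forces $d=0$, and then $v_i+d=v_j$ expresses it.
  refine ((add (n := n + 1) 0 0 0).and (add i.succ 0 j.succ)).ex.of_iff fun v => ?_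
  simp

end ArithDef

namespace ArithFun

variable {n : ℕ}

theorem weaken {f : (Fin n → ℕ) → ℕ} (hf : ArithFun f) :
    ArithFun fun v : Fin (n + 1) → ℕ => f (Fin.tail v) :=
  (ArithDef.rename hf (Fin.cons 0 fun i => i.succ.succ) :)

theorem var (i : Fin n) : ArithFun fun v => v i :=
  ArithDef.eq_var i.succ 0

end ArithFun

namespace ArithDef

variable {n m : ℕ}

theorem graph {f : (Fin n → ℕ) → ℕ} (hf : ArithFun f) (i : Fin n) :
    ArithDef fun v => f v = v i :=
  (hf.rename (Fin.cons i id) :)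

theorem ternary {R : ℕ → ℕ → ℕ → Prop}
    (hR : ∀ {m} (i j k : Fin m), ArithDef fun v => R (v i) (v j) (v k))
    {f g h : (Fin n → ℕ) → ℕ} (hf : ArithFun f) (hg : ArithFun g) (hh : ArithFun h) :
    ArithDef fun v => R (f v) (g v) (h v) := by
  have key : ArithDef fun v => ∃ a b c, f v = a ∧ g v = b ∧ h v = c ∧ R a b c :=
    -- The innermost quantifier owns index 0, so `a`, `b`, `c` have indices 2, 1, 0.
    exists' (exists' (exists' ((graph hf.weaken.weaken.weaken 2).and
      ((graph hg.weaken.weaken.weaken 1).and ((graph hh.weaken.weaken.weaken 0).and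
        (hR 2 1 0))))))
  exact key.of_iff fun v => by simp

/-- Only atoms need work: there, function values are named by existential quantifiers. Under a
quantifier the new variable is substituted by itself. -/
theorem comp {R : (Fin m → ℕ) → Prop} (hR : ArithDef R) {f : Fin m → (Fin n → ℕ) → ℕ}
    (hf : ∀ i, ArithFun (f i)) : ArithDef fun v => R fun i => f i v := by
  induction hR generalizing n with
  | add i j k => exact ternary (R := fun x y z => x + y = z) add (hf i) (hf j) (hf k)
  | mul i j k => exact ternary (R := fun x y z => x * y = z) mul (hf i) (hf j) (hf k)
  | neg _ ih => exact (ih hf).neg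
  | and _ _ ih₁ ih₂ => exact (ih₁ hf).and (ih₂ hf)
  | ex _ ih =>
    refine (ih (f := Fin.cons (fun v => v 0) fun i v => f i (Fin.tail v)) ?_).ex.of_iff
      fun v => exists_congr fun d => ?_
    · intro i
      cases i using Fin.cases with
      | zero => exact ArithFun.var 0
      | succ i => exact (hf i).weaken
    · refine iff_of_eq (congrArg _ (funext fun i => ?_))
      cases i using Fin.cases <;> simp

theorem comp₂ {R : ℕ → ℕ → Prop} (hR : ArithDef fun v : Fin 2 → ℕ => R (v 0) (v 1))
    {f g : (Fin n → ℕ) → ℕ} (hf : ArithFun f) (hg : ArithFun g) :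
    ArithDef fun v => R (f v) (g v) :=
  hR.comp (f := ![f, g]) (by simp [Fin.forall_fin_two, hf, hg])

theorem comp₃ {R : ℕ → ℕ → ℕ → Prop} (hR : ArithDef fun v : Fin 3 → ℕ => R (v 0) (v 1) (v 2))
    {f g h : (Fin n → ℕ) → ℕ} (hf : ArithFun f) (hg : ArithFun g) (hh : ArithFun h) :
    ArithDef fun v => R (f v) (g v) (h v) :=
  hR.comp (f := ![f, g, h]) (by simp [Fin.forall_fin_succ, hf, hg, hh])

theorem eq {f g : (Fin n → ℕ) → ℕ} (hf : ArithFun f) (hg : ArithFun g) :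
    ArithDef fun v => f v = g v :=
  (eq_var 0 1).comp₂ hf hg

end ArithDef

namespace ArithFun

variable {n : ℕ} {f g : (Fin n → ℕ) → ℕ}

open ArithDef (eq exists')

theorem comp {F : ℕ → ℕ} (hF : ArithDef fun v : Fin 2 → ℕ => F (v 0) = v 1) (hf : ArithFun f) :
    ArithFun fun v => F (f v) :=
  hF.comp₂ (R := fun x y => F x = y) hf.weaken (var 0)

theorem comp₂ {F : ℕ → ℕ → ℕ} (hF : ArithDef fun v : Fin 3 → ℕ => F (v 0) (v 1) = v 2)
    (hf : ArithFun f) (hg : ArithFun g) : ArithFun fun v => F (f v) (g v) :=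
  hF.comp₃ (R := fun x y z => F x y = z) hf.weaken hg.weaken (var 0)

theorem add (hf : ArithFun f) (hg : ArithFun g) : ArithFun fun v => f v + g v :=
  comp₂ (.add 0 1 2) hf hg

theorem mul (hf : ArithFun f) (hg : ArithFun g) : ArithFun fun v => f v * g v :=
  comp₂ (.mul 0 1 2) hf hg

theorem zero : ArithFun fun _ : Fin n → ℕ => 0 :=
  (ArithDef.add 0 0 0).of_iff fun v => by simp [eq_comm]

theorem one : ArithFun fun _ : Fin n → ℕ => 1 :=
  ((ArithDef.mul 0 0 0).and (eq (var 0) zero).neg).of_iff fun v => by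
    rcases v 0 with _ | _ | k <;> simp

theorem succ (hf : ArithFun f) : ArithFun fun v => f v + 1 := hf.add one

end ArithFun

namespace ArithDef

variable {n : ℕ} {f g : (Fin n → ℕ) → ℕ}

open ArithFun (var)

theorem lt (hf : ArithFun f) (hg : ArithFun g) : ArithDef fun v => f v < g v := by
  have key : ArithDef fun v => ∃ d, f v + 1 + d = g v :=
    exists' (eq (hf.weaken.succ.add (var 0)) hg.weaken)
  exact key.of_iff fun v => by
    rw [← Nat.succ_le_iff, le_iff_exists_add]
    simp [eq_comm]

end ArithDef

namespace ArithFun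

variable {n : ℕ} {f g : (Fin n → ℕ) → ℕ}

open ArithDef (eq exists' lt)

theorem mod (hf : ArithFun f) (hg : ArithFun g) : ArithFun fun v => f v % g v := by
  refine comp₂ (F := fun x y => x % y) ?_ hf hg
  -- The first disjunct covers the convention `x % 0 = x`.
  have key : ArithDef fun v : Fin 3 → ℕ => (v 1 = 0 ∧ v 0 = v 2) ∨
      (v 2 < v 1 ∧ ∃ q, v 2 + v 1 * q = v 0) :=
    ((eq (var 1) zero).and (eq (var 0) (var 2))).or
      ((lt (var 2) (var 1)).and
        (exists' (eq ((var 2).weaken.add ((var 1).weaken.mul (var 0))) (var 0).weaken)))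
  refine key.of_iff fun v => ?_
  constructor
  · intro h
    rcases Nat.eq_zero_or_pos (v 1) with h₁ | h₁
    · exact .inl ⟨h₁, by simpa [h₁] using h⟩
    · exact .inr ⟨h ▸ Nat.mod_lt _ h₁, v 0 / v 1, h ▸ Nat.mod_add_div _ _⟩
  · rintro (⟨h₁, h⟩ | ⟨h, q, hq⟩)
    · simp [h₁, h]
    · rw [← hq, Nat.add_mul_mod_self_left, Nat.mod_eq_of_lt h]

theorem pair (hf : ArithFun f) (hg : ArithFun g) : ArithFun fun v => Nat.pair (f v) (g v) := by
  refine comp₂ ?_ hf hg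
  have key : ArithDef fun v : Fin 3 → ℕ => (v 0 < v 1 ∧ v 1 * v 1 + v 0 = v 2) ∨
      (¬ v 0 < v 1 ∧ v 0 * v 0 + v 0 + v 1 = v 2) :=
    ((lt (var 0) (var 1)).and (eq (((var 1).mul (var 1)).add (var 0)) (var 2))).or
      ((lt (var 0) (var 1)).neg.and
        (eq ((((var 0).mul (var 0)).add (var 0)).add (var 1)) (var 2)))
  refine key.of_iff fun v => ?_
  unfold Nat.pair
  split_ifs <;> simp [*]

theorem unpair_fst (hf : ArithFun f) : ArithFun fun v => (f v).unpair.1 := by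
  refine comp (F := fun x => x.unpair.1) ?_ hf
  have key : ArithDef fun v : Fin 2 → ℕ => ∃ b, Nat.pair (v 1) b = v 0 :=
    exists' (eq ((var 1).weaken.pair (var 0)) (var 0).weaken)
  refine key.of_iff fun v => ⟨?_, ?_⟩
  · rintro h
    exact ⟨(v 0).unpair.2, by rw [← h, Nat.pair_unpair]⟩
  · rintro ⟨b, hb⟩
    rw [← hb, Nat.unpair_pair]

theorem unpair_snd (hf : ArithFun f) : ArithFun fun v => (f v).unpair.2 := by
  refine comp (F := fun x => x.unpair.2) ?_ hf
  have key : ArithDef fun v : Fin 2 → ℕ => ∃ a, Nat.pair a (v 1) = v 0 :=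
    exists' (eq ((var 0).pair (var 1).weaken) (var 0).weaken)
  refine key.of_iff fun v => ⟨?_, ?_⟩
  · rintro h
    exact ⟨(v 0).unpair.1, by rw [← h, Nat.pair_unpair]⟩
  · rintro ⟨b, hb⟩
    rw [← hb, Nat.unpair_pair]

theorem beta (hf : ArithFun f) (hg : ArithFun g) : ArithFun fun v => Nat.beta (f v) (g v) :=
  hf.unpair_fst.mod ((hg.succ.mul hf.unpair_snd).succ)

end ArithFun

/-! ### Gödel's β-function and graphs of partial recursive functions -/

theorem exists_beta_eq (h : ℕ → ℕ) (n : ℕ) : ∃ s, ∀ i ≤ n, Nat.beta s i = h i := by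
  refine ⟨Nat.unbeta (List.ofFn fun i : Fin (n + 1) => h i), fun i hi => ?_⟩
  refine (Nat.beta_unbeta_coe (List.ofFn fun i : Fin (n + 1) => h i)
    ⟨i, by simpa using Nat.lt_succ_of_le hi⟩).trans ?_
  simp only [Fin.getElem_fin, List.getElem_ofFn]

/-- A terminating recursion has a finite sequence of intermediate values, which a single number `s`
codes through β; this replaces recursion by first-order quantification. -/
theorem mem_rec_iff_exists_beta (f : Part ℕ) (g : ℕ → ℕ →. ℕ) (n y : ℕ) :
    y ∈ (Nat.rec f (fun i IH => IH.bind (g i)) n : Part ℕ) ↔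
      ∃ s, Nat.beta s 0 ∈ f ∧ (∀ i, i < n → Nat.beta s (i + 1) ∈ g i (Nat.beta s i)) ∧
        Nat.beta s n = y := by
  constructor
  · intro hy
    obtain ⟨h, h₀, h₁, h₂⟩ : ∃ h : ℕ → ℕ, h 0 ∈ f ∧ (∀ i, i < n → h (i + 1) ∈ g i (h i)) ∧
        h n = y := by
      induction n generalizing y with
      | zero => exact ⟨fun _ => y, hy, by simp, rfl⟩
      | succ n ih =>
        obtain ⟨z, hz, hyz⟩ := Part.mem_bind_iff.1 hy
        obtain ⟨h, h₀, h₁, h₂⟩ := ih z hz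
        refine ⟨Function.update h (n + 1) y, by simpa using h₀, fun i hi => ?_, by simp⟩
        rcases Nat.lt_succ_iff_lt_or_eq.1 hi with hi | rfl
        · rw [Function.update_of_ne (by omega), Function.update_of_ne (by omega)]
          exact h₁ i hi
        · rw [Function.update_self, Function.update_of_ne (by omega), h₂]
          exact hyz
    obtain ⟨s, hs⟩ := exists_beta_eq h n
    refine ⟨s, by rwa [hs 0 (by omega)], fun i hi => ?_, by rwa [hs n le_rfl]⟩
    rw [hs _ hi, hs _ hi.le]
    exact h₁ i hi
  · rintro ⟨s, h₀, h₁, rfl⟩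
    induction n with
    | zero => exact h₀
    | succ n ih =>
      exact Part.mem_bind_iff.2 ⟨_, ih fun i hi => h₁ i (by omega), h₁ n (by omega)⟩

open ArithDef ArithFun in
/-- The graphs of partial recursive functions are arithmetical. -/
theorem arithDef_of_partrec {f : ℕ →. ℕ} (hf : Nat.Partrec f) :
    ArithDef fun v : Fin 2 → ℕ => v 1 ∈ f (v 0) := by
  induction hf with
  | zero => exact (eq (var 1) zero).of_iff fun v => Part.mem_some_iff
  | succ => exact (eq (var 1) (var 0).succ).of_iff fun v => Part.mem_some_iff
  | left => exact (eq (var 1) (var 0).unpair_fst).of_iff fun v => Part.mem_some_iff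
  | right => exact (eq (var 1) (var 0).unpair_snd).of_iff fun v => Part.mem_some_iff
  | @pair f g _ _ hf hg =>
    have key : ArithDef fun v : Fin 2 → ℕ =>
        ∃ a b, a ∈ f (v 0) ∧ b ∈ g (v 0) ∧ Nat.pair a b = v 1 :=
      exists' (exists' ((hf.comp₂ (R := fun x y => y ∈ f x) (var 2) (var 1)).and
        ((hg.comp₂ (R := fun x y => y ∈ g x) (var 2) (var 0)).and
          (eq ((var 1).pair (var 0)) (var 3)))))
    refine key.of_iff fun v => ?_
    simp [Seq.seq]
  | @comp f g _ _ hf hg =>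
    have key : ArithDef fun v : Fin 2 → ℕ => ∃ a, a ∈ g (v 0) ∧ v 1 ∈ f a :=
      exists' ((hg.comp₂ (R := fun x y => y ∈ g x) (var 1) (var 0)).and
        (hf.comp₂ (R := fun x y => y ∈ f x) (var 0) (var 2)))
    exact key.of_iff fun v => Part.mem_bind_iff
  | @prec f g _ _ hf hg =>
    have key : ArithDef fun v : Fin 2 → ℕ => ∃ s, Nat.beta s 0 ∈ f (v 0).unpair.1 ∧
        (∀ i, i < (v 0).unpair.2 → Nat.beta s (i + 1) ∈
          g (Nat.pair (v 0).unpair.1 (Nat.pair i (Nat.beta s i)))) ∧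
        Nat.beta s (v 0).unpair.2 = v 1 :=
      exists' ((hf.comp₂ (R := fun x y => y ∈ f x) (var 1).unpair_fst ((var 0).beta zero)).and
        ((forall' ((lt (var 0) (var 2).unpair_snd).imp
          (hg.comp₂ (R := fun x y => y ∈ g x)
            ((var 2).unpair_fst.pair ((var 0).pair ((var 1).beta (var 0))))
            ((var 1).beta (var 0).succ)))).and
          (eq ((var 0).beta (var 1).unpair_snd) (var 2))))
    exact key.of_iff fun v => mem_rec_iff_exists_beta (f (v 0).unpair.1)
      (fun i j => g (Nat.pair (v 0).unpair.1 (Nat.pair i j))) (v 0).unpair.2 (v 1)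
  | @rfind f _ hf =>
    have key : ArithDef fun v : Fin 2 → ℕ => 0 ∈ f (Nat.pair (v 0) (v 1)) ∧
        ∀ m, m < v 1 → ∃ k, k ∈ f (Nat.pair (v 0) m) ∧ ¬ k = 0 :=
      (hf.comp₂ (R := fun x y => y ∈ f x) ((var 0).pair (var 1)) zero).and
        (forall' ((lt (var 0) (var 2)).imp (exists'
          ((hf.comp₂ (R := fun x y => y ∈ f x) ((var 2).pair (var 1)) (var 0)).and
            (eq (var 0) zero).neg))))
    refine key.of_iff fun v => ?_
    refine Nat.mem_rfind.trans ?_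
    simp

end FOTC

/-! ### Translation to the grid and reduction from the halting problem -/

namespace FOTC

open Formula

/-- Arithmetical relations are definable on the horizontal axis of the grid, with any choice of
names for the variables. -/
theorem ArithDef.exists_formula {n : ℕ} {R : (Fin n → ℕ) → Prop} (hR : ArithDef R) (σ : Fin n → ℕ) :
    ∃ φ ∈ ParamFreeFragment (Fin 2) 1 2, φ.free ⊆ Finset.univ.image σ ∧
      ∀ (v : ℕ → ℕ × ℕ) (w : Fin n → ℕ), (∀ i, v (σ i) = (w i, 0)) → (φ.Sat grid v ↔ R w) := by
  induction hR with
  | add i j k =>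
    refine ⟨addFormula (σ i) (σ j) (σ k), addFormula_mem _ _ _ _,
      (free_addFormula _ _ _).trans ?_, fun v w h => ?_⟩
    · simp [Finset.insert_subset_iff]
    · simp [sat_addFormula, h]
  | mul i j k =>
    refine ⟨mulFormula (σ i) (σ j) (σ k), mulFormula_mem _ _ _,
      (free_mulFormula _ _ _).trans ?_, fun v w h => ?_⟩
    · simp [Finset.insert_subset_iff]
    · simp [sat_mulFormula, h]
  | neg _ ih =>
    obtain ⟨φ, hφ, hfree, hsat⟩ := ih σ
    exact ⟨Formula.neg φ, neg_mem_fragment hφ, hfree, fun v w h => not_congr (hsat v w h)⟩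
  | and _ _ ih₁ ih₂ =>
    obtain ⟨φ, hφ, hfree, hsat⟩ := ih₁ σ
    obtain ⟨ψ, hψ, hfree', hsat'⟩ := ih₂ σ
    exact ⟨Formula.and φ ψ, and_mem_fragment hφ hψ, Finset.union_subset hfree hfree',
      fun v w h => and_congr (hsat v w h) (hsat' v w h)⟩
  | ex _ ih =>
    -- A fresh name keeps the values of the other variables; the quantifier is then relativized to
    -- the axis.
    obtain ⟨x, hx⟩ := Infinite.exists_notMem_finset (Finset.univ.image σ)
    have hne (i) : σ i ≠ x := fun h => hx (by simp [← h])
    obtain ⟨φ, hφ, hfree, hsat⟩ := ih (Fin.cons x σ)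
    refine ⟨Formula.ex x (Formula.and (onAxis x) φ),
      ex_mem_fragment _ (and_mem_fragment (onAxis_mem _ _) hφ), free_ex_subset ?_,
      fun v w h => ?_⟩
    · refine Finset.union_subset (by simp [free_onAxis]) (hfree.trans ?_)
      intro z hz
      simpa [Fin.exists_fin_succ, eq_comm] using hz
    · have key (d : ℕ) := hsat (Function.update v x (d, 0)) (Fin.cons d w) fun i => by
        cases i using Fin.cases <;> simp [hne, h]
      simp only [Sat, sat_onAxis, Function.update_self, Prod.exists]
      constructor
      · rintro ⟨d, _, rfl, hd⟩
        exact ⟨d, (key d).1 hd⟩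
      · rintro ⟨d, hd⟩
        exact ⟨d, 0, rfl, (key d).2 hd⟩

/-- `φ` with the vertex `0` moved `k` steps to the right. -/
def shift (φ : Formula (Fin 2)) : ℕ → Formula (Fin 2)
  | 0 => φ
  | k + 1 => ex 1 (and (edge 0 0 1) (ex 0 (and (eq 0 1) (shift φ k))))

/-- The sentence saying that `φ` holds at the vertex `(k, 0)`. -/
def instantiate (φ : Formula (Fin 2)) (k : ℕ) : Formula (Fin 2) :=
  ex 0 (and (and (onAxis 0) (onLeft 0)) (shift φ k))

section Instantiate

variable {φ : Formula (Fin 2)}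

theorem shift_mem {l : ℕ} (hφ : φ ∈ ParamFreeFragment (Fin 2) 1 l) (k : ℕ) :
    shift φ k ∈ ParamFreeFragment (Fin 2) 1 l := by
  induction k with
  | zero => exact hφ
  | succ k ih =>
    exact ex_mem_fragment _ (and_mem_fragment (edge_mem_fragment _ _ _)
      (ex_mem_fragment _ (and_mem_fragment (eq_mem_fragment _ _) ih)))

theorem instantiate_mem {l : ℕ} (hφ : φ ∈ ParamFreeFragment (Fin 2) 1 l) (k : ℕ) :
    instantiate φ k ∈ ParamFreeFragment (Fin 2) 1 l :=
  ex_mem_fragment _ (and_mem_fragment (and_mem_fragment (onAxis_mem _ _) (onLeft_mem _ _))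
    (shift_mem hφ k))

theorem free_shift (hφ : φ.free ⊆ {0}) (k : ℕ) : (shift φ k).free ⊆ {0} := by
  induction k with
  | zero => exact hφ
  | succ k ih =>
    intro z hz
    have := @ih z
    simp [shift, free] at hz this ⊢
    tauto

theorem free_instantiate (hφ : φ.free ⊆ {0}) (k : ℕ) : (instantiate φ k).free = ∅ := by
  refine Finset.subset_empty.1 (free_ex_subset ?_)
  refine Finset.union_subset ?_ (free_shift hφ k)
  simp [free, free_onAxis, free_onLeft]

theorem sat_shift {P : ℕ → Prop}
    (hP : ∀ (v : ℕ → ℕ × ℕ) (a : ℕ), v 0 = (a, 0) → (φ.Sat grid v ↔ P a)) (k : ℕ)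
    (v : ℕ → ℕ × ℕ) (a : ℕ) (hv : v 0 = (a, 0)) : (shift φ k).Sat grid v ↔ P (a + k) := by
  induction k generalizing v a with
  | zero => exact hP v a hv
  | succ k ih =>
    have key (x) := ih (Function.update (Function.update v 1 x) 0 (a + 1, 0)) (a + 1) (by simp)
    simp [shift, Sat, grid, hv, key, add_right_comm, add_assoc]

theorem sat_instantiate {P : ℕ → Prop}
    (hP : ∀ (v : ℕ → ℕ × ℕ) (a : ℕ), v 0 = (a, 0) → (φ.Sat grid v ↔ P a)) (k : ℕ)
    (v : ℕ → ℕ × ℕ) : (instantiate φ k).Sat grid v ↔ P k := by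
  have key := sat_shift hP k (Function.update v 0 (0, 0)) 0 (by simp)
  simp only [instantiate, Sat, sat_onAxis, sat_onLeft, Function.update_self]
  rw [zero_add] at key
  rw [← key]
  constructor
  · rintro ⟨⟨_, _⟩, ⟨rfl, rfl⟩, h⟩
    exact h
  · exact fun h => ⟨(0, 0), ⟨rfl, rfl⟩, h⟩

/-- Shifting reuses the variables 0 and 1 at every level, so each step wraps the Gödel number in one
fixed context and the code is given by primitive recursion on `k`. -/
theorem primrec_code_instantiate (φ : Formula (Fin 2)) :
    Primrec fun k => (instantiate φ k).code := by
  have pairC (c : ℕ) {f : ℕ → ℕ} (hf : Primrec f) : Primrec fun r => Nat.pair c (f r) :=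
    Primrec₂.natPair.comp (Primrec.const c) hf
  have hstep : Primrec fun r : ℕ =>
      Nat.pair 4 (Nat.pair 1 (Nat.pair 3 (Nat.pair (edge (0 : Fin 2) 0 1).code
        (Nat.pair 4 (Nat.pair 0 (Nat.pair 3 (Nat.pair (eq (A := Fin 2) 0 1).code r))))))) :=
    pairC _ (pairC _ (pairC _ (pairC _ (pairC _ (pairC _ (pairC _ (pairC _ Primrec.id)))))))
  have hshift : Primrec fun k => (shift φ k).code := by
    refine (Primrec.nat_rec₁ φ.code (hstep.comp Primrec.snd).to₂).of_eq fun k => ?_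
    induction k with
    | zero => rfl
    | succ k ih =>
      simp only [code] at ih
      simp only [shift, code, ih]
  exact pairC 4 (pairC 0 (pairC 3 (pairC (and (onAxis 0) (onLeft 0)).code hshift)))

end Instantiate

/-- Evaluating the `a`-th code at 0 is partial recursive in `a`, so its graph is arithmetical, and
projecting out the output defines the domain. -/
theorem exists_formula_halting : ∃ φ ∈ ParamFreeFragment (Fin 2) 1 2, φ.free ⊆ {0} ∧
    ∀ (v : ℕ → ℕ × ℕ) (a : ℕ), v 0 = (a, 0) →
      (φ.Sat grid v ↔ ((Denumerable.ofNat Nat.Partrec.Code a).eval 0).Dom) := by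
  have hf : Nat.Partrec fun a => (Denumerable.ofNat Nat.Partrec.Code a).eval 0 :=
    Partrec.nat_iff.1 (Nat.Partrec.Code.eval_part.comp (Computable.ofNat _) (Computable.const 0))
  have hdom : ArithDef fun v : Fin 1 → ℕ =>
      ∃ y, y ∈ (Denumerable.ofNat Nat.Partrec.Code (v 0)).eval 0 :=
    .exists' ((arithDef_of_partrec hf).comp₂
      (R := fun x y => y ∈ (Denumerable.ofNat Nat.Partrec.Code x).eval 0) (.var 1) (.var 0))
  obtain ⟨φ, hφ, hfree, hsat⟩ := hdom.exists_formula fun _ => 0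
  refine ⟨φ, hφ, by simpa using hfree, fun v a hv => ?_⟩
  rw [hsat v (fun _ => a) fun _ => hv, Part.dom_iff_mem]

theorem not_isDecidable_theoryIn {L : Set (Formula (Fin 2))}
    (hL : ParamFreeFragment (Fin 2) 1 2 ⊆ L) : ¬ IsDecidable (theoryIn L grid) := by
  obtain ⟨φ, hφ, hfree, hsat⟩ := exists_formula_halting
  intro h
  refine ComputablePred.halting_problem 0 (ComputablePred.computable_of_manyOneReducible
    ⟨fun c => (instantiate φ (Encodable.encode c)).code,
      (primrec_code_instantiate φ).to_comp.comp Computable.encode, fun c => ?_⟩ h)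
  have key := sat_instantiate hsat (Encodable.encode c)
  rw [Denumerable.ofNat_encode] at key
  constructor
  · exact fun hc => ⟨_, ⟨hL (instantiate_mem hφ _), free_instantiate hfree _,
      fun v => (key v).2 hc⟩, rfl⟩
  · rintro ⟨ψ, ⟨-, -, hψ⟩, hcode⟩
    -- Membership only yields some true sentence with the right Gödel number; injectivity of the
    -- coding identifies it with the instance for `c`.
    rw [code_injective hcode] at hψ
    exact (key fun _ => (0, 0)).1 (hψ _)

end FOTC

/-- The FO(TC)_(1)^2-theory of the infinite grid is undecidable, even for TC operators without
parameters; addition and multiplication of natural numbers are interpretable in that logic. -/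
theorem theorem4p2 :
    ¬ FOTC.IsDecidable (FOTC.theoryIn (FOTC.ParamFreeFragment (Fin 2) 1 2) FOTC.grid) ∧
    ¬ FOTC.IsDecidable (FOTC.theoryIn (FOTC.Fragment (Fin 2) 1 2) FOTC.grid) ∧
    FOTC.InterpretsArithmetic (FOTC.ParamFreeFragment (Fin 2) 1 2) :=
  ⟨FOTC.not_isDecidable_theoryIn subset_rfl, FOTC.not_isDecidable_theoryIn fun _ h => h.1,
    FOTC.interpretsArithmetic_paramFreeFragment⟩
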